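/- Let $\mathcal X,\mathcal Y$ (questions) and $\mathcal A,\mathcal B$ (answers) be finite alphabets. A two-prover game $G=(\pi,V)$ consists of a probability distribution $\pi$ on $\mathcal X\times\mathcal Y$ and a predicate $V:\mathcal A\times\mathcal B\times\mathcal X\times\mathcal Y\to\{0,1\}$. Its classical value is $$\omega(G)=\max_{s_A:\mathcal X\to\mathcal A,\ s_B:\mathcal Y\to\mathcal B}\ \sum_{x,y}\pi(x,y)\,V(s_A(x),s_B(y),x,y),$$ and its entangled value is $$\omega^*(G)=\lim_{d\to\infty}\ \max_{|\Psi\rangle}\ \max_{M_x^a,N_y^b}\ \sum_{x,y}\pi(x,y)\sum_{a,b}V(a,b,x,y)\,\langle\Psi|M_x^a\otimes N_y^b|\Psi\rangle,$$ where $|\Psi\rangle$ ranges over the unit vectors of $\mathbb C^d\otimes\mathbb C^d$ and, for all $x$ and $y$, $\{M_x^a\}_{a\in\mathcal A}$ and $\{N_y^b\}_{b\in\mathcal B}$ range over the projective measurements on $\mathbb C^d$. Put $K=\frac{\pi}{2\ln(1+\sqrt2)}$ (here $\pi=3.14\ldots$). Then every such game satisfies $$\omega^*(G)\le K\sqrt{|\mathcal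 A||\mathcal B|}\;\omega(G),$$ and therefore $$\sup\left\{\frac{\omega^*(G)}{\omega(G)} : G=(\pi,V)\text{ a two-prover game with these alphabets},\ \omega(G)\neq 0\right\}\le K\sqrt{|\mathcal A||\mathcal B|}.$$ The bound does not depend on $|\mathcal X|$ and $|\mathcal Y|$. -/

import Mathlib

/-- A two-prover game `(π, V)` with question alphabets `X`, `Y` and answer alphabets `A`, `B`:
a probability distribution `prob` on pairs of questions and a `{0, 1}`-valued predicate `pred`. -/
structure TwoProverGame (X Y A B : Type*) [Fintype X] [Fintype Y] where
  prob : X → Y → ℝ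
  prob_nonneg : ∀ x y, 0 ≤ prob x y
  prob_sum : ∑ x, ∑ y, prob x y = 1
  pred : A → B → X → Y → Bool

/-- A projective measurement on `ℂ^d` with outcomes in `A`: mutually orthogonal orthogonal
projections that sum to the identity. -/
structure IsProjectiveMeasurement {A : Type*} [Fintype A] {d : ℕ}
    (M : A → Matrix (Fin d) (Fin d) ℂ) : Prop where
  isHermitian : ∀ a, (M a).IsHermitian
  mul_self : ∀ a, M a * M a = M a
  mul_of_ne : ∀ a a', a ≠ a' → M a * M a' = 0
  sum_eq_one : ∑ a, M a = 1

/-- The number `⟨Ψ| M ⊗ N |Ψ⟩` for `Ψ ∈ ℂ^d ⊗ ℂ^d`, where `ℂ^d ⊗ ℂ^d` is identified with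
`ℂ^(d × d)` and `M ⊗ N` is the Kronecker product. It is real when `M` and `N` are Hermitian. -/
noncomputable def outcomeProb {d : ℕ} (ψ : Fin d × Fin d → ℂ)
    (M N : Matrix (Fin d) (Fin d) ℂ) : ℝ :=
  (star ψ ⬝ᵥ (Matrix.kronecker M N).mulVec ψ).re

namespace TwoProverGame

variable {X Y A B : Type*} [Fintype X] [Fintype Y] [Fintype A] [Fintype B]

/-- The winning probability of a deterministic strategy `(sA, sB)`. -/
noncomputable def strategyValue (G : TwoProverGame X Y A B) (sA : X → A) (sB : Y → B) : ℝ :=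
  ∑ x, ∑ y, G.prob x y * (if G.pred (sA x) (sB y) x y then 1 else 0)

/-- The classical value `ω(G)`: the maximum over the finitely many pairs of deterministic
strategies. -/
noncomputable def classicalValue (G : TwoProverGame X Y A B) : ℝ :=
  ⨆ s : (X → A) × (Y → B), G.strategyValue s.1 s.2

/-- The winning probability of the entangled strategy in which the provers share the state `ψ` and
measure `M x`, respectively `N y`, on the questions `x`, `y`. -/
noncomputable def quantumStrategyValue (G : TwoProverGame X Y A B) {d : ℕ}
    (ψ : Fin d × Fin d → ℂ) (M : X → A → Matrix (Fin d) (Fin d) ℂ)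
    (N : Y → B → Matrix (Fin d) (Fin d) ℂ) : ℝ :=
  ∑ x, ∑ y, G.prob x y *
    ∑ a, ∑ b, (if G.pred a b x y then 1 else 0) * outcomeProb ψ (M x a) (N y b)

/-- The winning probabilities of all entangled strategies of local dimension `d`: a shared unit
vector of `ℂ^d ⊗ ℂ^d` and projective measurements on both sides. -/
def quantumValues (G : TwoProverGame X Y A B) (d : ℕ) : Set ℝ :=
  {r | ∃ (ψ : Fin d × Fin d → ℂ) (M : X → A → Matrix (Fin d) (Fin d) ℂ)
      (N : Y → B → Matrix (Fin d) (Fin d) ℂ),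
    star ψ ⬝ᵥ ψ = 1 ∧ (∀ x, IsProjectiveMeasurement (M x)) ∧
    (∀ y, IsProjectiveMeasurement (N y)) ∧ r = G.quantumStrategyValue ψ M N}

/-- The best winning probability of entangled strategies of local dimension `d`. -/
noncomputable def entangledValueDim (G : TwoProverGame X Y A B) (d : ℕ) : ℝ :=
  sSup (G.quantumValues d)

/-- The entangled value `ω*(G)`: the limit of the best winning probabilities as the local dimension
tends to infinity. The limit exists, see `tendsto_entangledValue`. -/
noncomputable def entangledValue (G : TwoProverGame X Y A B) : ℝ :=
  Filter.atTop.limUnder G.entangledValueDim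

/-- The supremum, in the extended reals, of `ω*(G) / ω(G)` over all games `G` with the given
alphabets for which the quotient is defined. -/
noncomputable def maximalRatio (X Y A B : Type*) [Fintype X] [Fintype Y] [Fintype A]
    [Fintype B] : EReal :=
  ⨆ (G : TwoProverGame X Y A B) (_ : G.classicalValue ≠ 0),
    ((G.entangledValue / G.classicalValue : ℝ) : EReal)

end TwoProverGame

/-! ### The limit that defines the entangled value exists -/

section Limit

open Matrix ComplexOrder

theorem outcomeProb_nonneg {d : ℕ} (ψ : Fin d × Fin d → ℂ) {M N : Matrix (Fin d) (Fin d) ℂ}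
    (hM : M.IsHermitian) (hM2 : M * M = M) (hN : N.IsHermitian) (hN2 : N * N = N) :
    0 ≤ outcomeProb ψ M N := by
  have h : (Matrix.kronecker M N).PosSemidef := by
    have h1 : Matrix.kronecker M N = (Matrix.kronecker M N)ᴴ * Matrix.kronecker M N := by
      simp only [Matrix.kronecker]
      rw [Matrix.conjTranspose_kronecker, hM.eq, hN.eq, ← Matrix.mul_kronecker_mul, hM2, hN2]
    rw [h1]
    exact Matrix.posSemidef_conjTranspose_mul_self _
  exact (Complex.le_def.mp (h.dotProduct_mulVec_nonneg ψ)).1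

theorem outcomeProb_sum {d : ℕ} {A B : Type*} [Fintype A] [Fintype B] (ψ : Fin d × Fin d → ℂ)
    (hψ : star ψ ⬝ᵥ ψ = 1)
    {M : A → Matrix (Fin d) (Fin d) ℂ} {N : B → Matrix (Fin d) (Fin d) ℂ}
    (hM : IsProjectiveMeasurement M) (hN : IsProjectiveMeasurement N) :
    ∑ a, ∑ b, outcomeProb ψ (M a) (N b) = 1 := by
  have h : ∑ a, ∑ b, Matrix.kronecker (M a) (N b) = 1 := by
    have : Matrix.kronecker (∑ a, M a) (∑ b, N b) = ∑ a, ∑ b, Matrix.kronecker (M a) (N b) := by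
      ext i j
      simp [Matrix.kronecker, Matrix.kroneckerMap_apply, Matrix.sum_apply, Finset.sum_mul_sum]
    rw [← this, hM.sum_eq_one, hN.sum_eq_one]
    exact Matrix.one_kronecker_one
  have h2 : ∑ a, ∑ b, outcomeProb ψ (M a) (N b)
      = (star ψ ⬝ᵥ (∑ a, ∑ b, Matrix.kronecker (M a) (N b)) *ᵥ ψ).re := by
    simp only [outcomeProb, Matrix.sum_mulVec, dotProduct_sum, Complex.re_sum]
  rw [h2, h, Matrix.one_mulVec, hψ, Complex.one_re]

/-- An isometry `J` turns a projective measurement into one on the larger space: the complement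
of the range of `J` is added to the outcome `a₀`. -/
theorem IsProjectiveMeasurement.dilate {d e : ℕ} {A : Type*} [Fintype A] [DecidableEq A]
    {M : A → Matrix (Fin d) (Fin d) ℂ} (hM : IsProjectiveMeasurement M)
    {J : Matrix (Fin e) (Fin d) ℂ} (hJ : Jᴴ * J = 1) (a₀ : A) :
    IsProjectiveMeasurement (fun a => J * M a * Jᴴ + if a = a₀ then 1 - J * Jᴴ else 0) := by
  have hJl : ∀ P : Matrix (Fin d) (Fin e) ℂ, Jᴴ * (J * P) = P := fun P => by
    rw [← Matrix.mul_assoc, hJ, Matrix.one_mul]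
  constructor
  · intro a
    have := (hM.isHermitian a).eq
    split_ifs <;> simp [Matrix.IsHermitian, this, Matrix.mul_assoc]
  · intro a
    have h := hM.mul_self a
    have h' : M a * (M a * Jᴴ) = M a * Jᴴ := by rw [← Matrix.mul_assoc, h]
    split_ifs <;> simp [Matrix.mul_add, Matrix.add_mul, Matrix.mul_sub, Matrix.sub_mul,
      Matrix.mul_assoc, hJl, h']
  · intro a a' haa
    have h := hM.mul_of_ne a a' haa
    have h' : M a * (M a' * Jᴴ) = 0 := by rw [← Matrix.mul_assoc, h, Matrix.zero_mul]
    split_ifs with h1 h2 h2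
    · exact absurd (h1.trans h2.symm) haa
    all_goals simp [Matrix.mul_add, Matrix.add_mul, Matrix.mul_sub, Matrix.sub_mul,
      Matrix.mul_assoc, hJl, h']
  · rw [Finset.sum_add_distrib, ← Matrix.sum_mul, ← Matrix.mul_sum, hM.sum_eq_one]
    simp

theorem outcomeProb_isometry {d e : ℕ} (ψ : Fin d × Fin d → ℂ) {J : Matrix (Fin e) (Fin d) ℂ}
    (P Q : Matrix (Fin e) (Fin e) ℂ) :
    outcomeProb ((Matrix.kronecker J J).mulVec ψ) P Q
      = outcomeProb ψ (Jᴴ * P * J) (Jᴴ * Q * J) := by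
  simp only [outcomeProb, Matrix.kronecker]
  rw [Matrix.star_mulVec, ← Matrix.dotProduct_mulVec, Matrix.mulVec_mulVec, Matrix.mulVec_mulVec,
    Matrix.conjTranspose_kronecker, ← Matrix.mul_kronecker_mul, ← Matrix.mul_kronecker_mul,
    Matrix.mul_assoc, Matrix.mul_assoc]

namespace TwoProverGame

variable {X Y A B : Type*} [Fintype X] [Fintype Y] [Fintype A] [Fintype B]

theorem quantumValues_subset_Icc (G : TwoProverGame X Y A B) (d : ℕ) :
    G.quantumValues d ⊆ Set.Icc 0 1 := by
  rintro r ⟨ψ, M, N, hψ, hM, hN, rfl⟩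
  have hp : ∀ x y a b, 0 ≤ outcomeProb ψ (M x a) (N y b) := fun x y a b =>
    outcomeProb_nonneg ψ ((hM x).isHermitian a) ((hM x).mul_self a) ((hN y).isHermitian b)
      ((hN y).mul_self b)
  constructor
  · refine Finset.sum_nonneg fun x _ => Finset.sum_nonneg fun y _ =>
      mul_nonneg (G.prob_nonneg x y) (Finset.sum_nonneg fun a _ => Finset.sum_nonneg fun b _ =>
        mul_nonneg ?_ (hp x y a b))
    split_ifs <;> norm_num
  · rw [← G.prob_sum]
    refine Finset.sum_le_sum fun x _ => Finset.sum_le_sum fun y _ =>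
      mul_le_of_le_one_right (G.prob_nonneg x y) ?_
    refine le_of_le_of_eq (Finset.sum_le_sum fun a _ => Finset.sum_le_sum fun b _ =>
      mul_le_of_le_one_left (hp x y a b) ?_) (outcomeProb_sum ψ hψ (hM x) (hN y))
    split_ifs <;> norm_num

theorem quantumValues_subset_succ (G : TwoProverGame X Y A B) (d : ℕ) :
    G.quantumValues d ⊆ G.quantumValues (d + 1) := by
  classical
  rintro r ⟨ψ, M, N, hψ, hM, hN, rfl⟩
  have hd : Nonempty (Fin d) := by
    by_contra h
    rw [not_nonempty_iff] at h
    simp [dotProduct] at hψ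
  have hXY : ∃ x y, G.prob x y ≠ 0 := by
    by_contra! h
    have := G.prob_sum
    simp [h] at this
  obtain ⟨x₀, y₀, -⟩ := hXY
  have hA : Nonempty A := by
    by_contra h
    rw [not_nonempty_iff] at h
    have := (hM x₀).sum_eq_one
    simp at this
  have hB : Nonempty B := by
    by_contra h
    rw [not_nonempty_iff] at h
    have := (hN y₀).sum_eq_one
    simp at this
  obtain ⟨a₀⟩ := hA
  obtain ⟨b₀⟩ := hB
  let J : Matrix (Fin (d + 1)) (Fin d) ℂ := Matrix.of fun i j => if i = j.castSucc then 1 else 0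
  have hJ : Jᴴ * J = 1 := by
    ext i j
    simp [J, Matrix.mul_apply, Matrix.one_apply, eq_comm]
  have hcomp : ∀ (c : Prop) [Decidable c] (P : Matrix (Fin d) (Fin d) ℂ),
      Jᴴ * (J * P * Jᴴ + if c then 1 - J * Jᴴ else 0) * J = P := by
    intro c _ P
    have hJl : ∀ Q : Matrix (Fin d) (Fin d) ℂ, Jᴴ * (J * Q) = Q := fun Q => by
      rw [← Matrix.mul_assoc, hJ, Matrix.one_mul]
    split_ifs <;> simp [Matrix.mul_add, Matrix.add_mul, Matrix.mul_sub, Matrix.sub_mul,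
      Matrix.mul_assoc, hJl, hJ]
  refine ⟨(Matrix.kronecker J J).mulVec ψ,
    fun x a => J * M x a * Jᴴ + if a = a₀ then 1 - J * Jᴴ else 0,
    fun y b => J * N y b * Jᴴ + if b = b₀ then 1 - J * Jᴴ else 0, ?_,
    fun x => (hM x).dilate hJ a₀, fun y => (hN y).dilate hJ b₀, ?_⟩
  · simp only [Matrix.kronecker]
    rw [Matrix.star_mulVec, ← Matrix.dotProduct_mulVec, Matrix.mulVec_mulVec,
      Matrix.conjTranspose_kronecker, ← Matrix.mul_kronecker_mul, hJ, Matrix.one_kronecker_one,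
      Matrix.one_mulVec, hψ]
  · simp only [quantumStrategyValue, outcomeProb_isometry]
    refine Finset.sum_congr rfl fun x _ => Finset.sum_congr rfl fun y _ => ?_
    congr 1
    refine Finset.sum_congr rfl fun a _ => Finset.sum_congr rfl fun b _ => ?_
    rw [hcomp, hcomp]

theorem monotone_entangledValueDim (G : TwoProverGame X Y A B) :
    Monotone G.entangledValueDim := by
  refine monotone_nat_of_le_succ fun d => ?_
  rcases (G.quantumValues d).eq_empty_or_nonempty with h | h
  · rw [entangledValueDim, h, Real.sSup_empty]
    exact Real.sSup_nonneg fun r hr => (G.quantumValues_subset_Icc _ hr).1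
  · exact csSup_le_csSup ⟨1, fun r hr => (G.quantumValues_subset_Icc _ hr).2⟩ h
      (G.quantumValues_subset_succ d)

theorem tendsto_entangledValue (G : TwoProverGame X Y A B) :
    Filter.Tendsto G.entangledValueDim Filter.atTop (nhds G.entangledValue) := by
  refine tendsto_nhds_limUnder ⟨_, tendsto_atTop_ciSup G.monotone_entangledValueDim ⟨1, ?_⟩⟩
  rintro _ ⟨d, rfl⟩
  exact Real.sSup_le (fun r hr => (G.quantumValues_subset_Icc _ hr).2) zero_le_one

end TwoProverGame

end Limit

/-! The measurements of each prover sum to the identity, so the joint outcome probability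
`p(a,b|x,y)` has marginals `p(a|x)` and `q(b|y)`, neither depending on the other prover's question.
The joint probability is at most each marginal, hence at most `√p(a|x) * √q(b|y)`. This is a product
strategy, except that its weights have total mass up to `√|A|` and `√|B|` by Cauchy–Schwarz
(`sum_sqrt_le_sqrt_card`). The winning probability is linear in the weights of each prover, so
deterministic answers do at least as well up to these masses (`sum_mul_le_mul_classicalValue`). This
already gives the bound with constant `1`, in every dimension. The constant `K` enters only through
`1 ≤ K`; no Grothendieck-type inequality is needed. -/

open Matrix in
theorem outcomeProb_sum_right {d : ℕ} {B : Type*} [Fintype B] (ψ : Fin d × Fin d → ℂ)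
    (M : Matrix (Fin d) (Fin d) ℂ) (N : B → Matrix (Fin d) (Fin d) ℂ) :
    ∑ b, outcomeProb ψ M (N b) = outcomeProb ψ M (∑ b, N b) := by
  have h : Matrix.kronecker M (∑ b, N b) = ∑ b, Matrix.kronecker M (N b) := by
    ext i j
    simp [Matrix.kronecker, Matrix.kroneckerMap_apply, Matrix.sum_apply, Finset.mul_sum]
  simp only [outcomeProb, h, Matrix.sum_mulVec, dotProduct_sum, Complex.re_sum]

open Matrix in
theorem outcomeProb_sum_left {d : ℕ} {A : Type*} [Fintype A] (ψ : Fin d × Fin d → ℂ)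
    (M : A → Matrix (Fin d) (Fin d) ℂ) (N : Matrix (Fin d) (Fin d) ℂ) :
    ∑ a, outcomeProb ψ (M a) N = outcomeProb ψ (∑ a, M a) N := by
  have h : Matrix.kronecker (∑ a, M a) N = ∑ a, Matrix.kronecker (M a) N := by
    ext i j
    simp [Matrix.kronecker, Matrix.kroneckerMap_apply, Matrix.sum_apply, Finset.sum_mul]
  simp only [outcomeProb, h, Matrix.sum_mulVec, dotProduct_sum, Complex.re_sum]

/-- The square roots of the probabilities of a distribution on `A` sum to at most `√|A|`. -/
theorem sum_sqrt_le_sqrt_card {A : Type*} [Fintype A] {p : A → ℝ} (hp : ∀ a, 0 ≤ p a)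
    (hsum : ∑ a, p a = 1) : ∑ a, √(p a) ≤ √(Fintype.card A : ℝ) := by
  refine Real.le_sqrt_of_sq_le ?_
  -- Cauchy–Schwarz against the constant vector `1`.
  have h := sq_sum_le_card_mul_sum_sq (s := Finset.univ) (f := fun a => √(p a))
  simpa [Real.sq_sqrt (hp _), hsum] using h

/-- A family of nonnegative weights of total mass at most `S` can be replaced, in a linear
expression with nonnegative coefficients, by `S` times a deterministic choice. -/
theorem exists_sum_mul_le_mul_sum {X A : Type*} [Fintype X] [Fintype A] [Nonempty A]
    {f c : X → A → ℝ} {S : ℝ} (hf : ∀ x a, 0 ≤ f x a) (hS : ∀ x, ∑ a, f x a ≤ S)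
    (hc : ∀ x a, 0 ≤ c x a) :
    ∃ s : X → A, ∑ x, ∑ a, f x a * c x a ≤ S * ∑ x, c x (s x) := by
  choose s hs using fun x => Finite.exists_max (c x)
  refine ⟨s, ?_⟩
  rw [Finset.mul_sum]
  refine Finset.sum_le_sum fun x _ => ?_
  calc ∑ a, f x a * c x a ≤ ∑ a, f x a * c x (s x) :=
        Finset.sum_le_sum fun a _ => mul_le_mul_of_nonneg_left (hs x a) (hf x a)
    _ = (∑ a, f x a) * c x (s x) := (Finset.sum_mul _ _ _).symm
    _ ≤ S * c x (s x) := mul_le_mul_of_nonneg_right (hS x) (hc x _)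

/-- Since `log (1 + t) ≤ t`, the denominator is at most `2√2 ≤ 3 < π`. -/
theorem one_le_pi_div_two_mul_log_one_add_sqrt_two :
    1 ≤ Real.pi / (2 * Real.log (1 + √2)) := by
  have h2 : (0 : ℝ) < √2 := by positivity
  have hlog : 0 < Real.log (1 + √2) := Real.log_pos (by linarith)
  have hle : Real.log (1 + √2) ≤ √2 := by
    have := Real.log_le_sub_one_of_pos (x := 1 + √2) (by linarith)
    linarith
  have hs : √2 ≤ 3 / 2 := Real.sqrt_le_iff.mpr ⟨by norm_num, by norm_num⟩
  rw [le_div_iff₀ (by linarith)]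
  linarith [Real.pi_gt_three]

/-! ### Rounding to deterministic strategies and the bound on the entangled value -/

namespace TwoProverGame

variable {X Y A B : Type*} [Fintype X] [Fintype Y]

theorem strategyValue_nonneg (G : TwoProverGame X Y A B) (sA : X → A) (sB : Y → B) :
    0 ≤ G.strategyValue sA sB := by
  refine Finset.sum_nonneg fun x _ => Finset.sum_nonneg fun y _ =>
    mul_nonneg (G.prob_nonneg x y) ?_
  split_ifs <;> norm_num

theorem classicalValue_nonneg (G : TwoProverGame X Y A B) : 0 ≤ G.classicalValue :=
  Real.iSup_nonneg fun s => G.strategyValue_nonneg s.1 s.2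

variable [Fintype A] [Fintype B]

theorem strategyValue_le_classicalValue (G : TwoProverGame X Y A B) (sA : X → A) (sB : Y → B) :
    G.strategyValue sA sB ≤ G.classicalValue :=
  le_ciSup (f := fun s : (X → A) × (Y → B) => G.strategyValue s.1 s.2)
    (Set.finite_range _).bddAbove (sA, sB)

/-- Unnormalized product strategies with local masses at most `S` and `T` win at most `S * T`
times the classical value. -/
theorem sum_mul_le_mul_classicalValue [Nonempty A] [Nonempty B] (G : TwoProverGame X Y A B)
    {f : X → A → ℝ} {g : Y → B → ℝ} {S T : ℝ} (hf : ∀ x a, 0 ≤ f x a) (hg : ∀ y b, 0 ≤ g y b)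
    (hS : ∀ x, ∑ a, f x a ≤ S) (hT : ∀ y, ∑ b, g y b ≤ T) (hS0 : 0 ≤ S) (hT0 : 0 ≤ T) :
    ∑ x, ∑ y, G.prob x y * ∑ a, ∑ b, (if G.pred a b x y then 1 else 0) * (f x a * g y b)
      ≤ S * T * G.classicalValue := by
  have hV : ∀ a b x y, (0 : ℝ) ≤ if G.pred a b x y then 1 else 0 := by
    intro a b x y
    split_ifs <;> norm_num
  -- Round one prover at a time: `sA` is the best reply to the weights `g`, with `c x a` the payoff
  -- of answering `a` to `x`.
  obtain ⟨sA, hA⟩ := exists_sum_mul_le_mul_sum (f := f) (S := S)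
    (c := fun x a => ∑ y, G.prob x y * ∑ b, (if G.pred a b x y then 1 else 0) * g y b) hf hS
    fun x a => Finset.sum_nonneg fun y _ => mul_nonneg (G.prob_nonneg x y)
      (Finset.sum_nonneg fun b _ => mul_nonneg (hV a b x y) (hg y b))
  -- Now `sB` is the best reply to the fixed `sA`.
  obtain ⟨sB, hB⟩ := exists_sum_mul_le_mul_sum (f := g) (S := T)
    (c := fun y b => ∑ x, G.prob x y * (if G.pred (sA x) b x y then 1 else 0)) hg hT
    fun y b => Finset.sum_nonneg fun x _ => mul_nonneg (G.prob_nonneg x y) (hV _ b x y)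
  calc _ = ∑ x, ∑ a, f x a *
        ∑ y, G.prob x y * ∑ b, (if G.pred a b x y then 1 else 0) * g y b := by
        refine Finset.sum_congr rfl fun x _ => ?_
        simp only [Finset.mul_sum]
        rw [Finset.sum_comm]
        refine Finset.sum_congr rfl fun a _ => Finset.sum_congr rfl fun y _ =>
          Finset.sum_congr rfl fun b _ => by ring
    _ ≤ S * ∑ x, ∑ y, G.prob x y * ∑ b, (if G.pred (sA x) b x y then 1 else 0) * g y b := hA
    _ = S * ∑ y, ∑ b, g y b * ∑ x, G.prob x y * (if G.pred (sA x) b x y then 1 else 0) := by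
        rw [Finset.sum_comm]
        congr 1
        refine Finset.sum_congr rfl fun y _ => ?_
        simp only [Finset.mul_sum]
        rw [Finset.sum_comm]
        refine Finset.sum_congr rfl fun b _ => Finset.sum_congr rfl fun x _ => by ring
    _ ≤ S * (T * ∑ y, ∑ x, G.prob x y * (if G.pred (sA x) (sB y) x y then 1 else 0)) :=
        mul_le_mul_of_nonneg_left hB hS0
    _ = S * T * G.strategyValue sA sB := by
        rw [Finset.sum_comm, strategyValue, mul_assoc]
    _ ≤ S * T * G.classicalValue :=
        mul_le_mul_of_nonneg_left (G.strategyValue_le_classicalValue sA sB) (mul_nonneg hS0 hT0)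

open Matrix in
/-- Every joint outcome probability is at most the geometric mean of its two marginals, which
reduces an entangled strategy to an unnormalized product strategy. -/
theorem quantumStrategyValue_le (G : TwoProverGame X Y A B) {d : ℕ} {ψ : Fin d × Fin d → ℂ}
    (hψ : star ψ ⬝ᵥ ψ = 1) {M : X → A → Matrix (Fin d) (Fin d) ℂ}
    {N : Y → B → Matrix (Fin d) (Fin d) ℂ} (hM : ∀ x, IsProjectiveMeasurement (M x))
    (hN : ∀ y, IsProjectiveMeasurement (N y)) :
    G.quantumStrategyValue ψ M N
      ≤ √(Fintype.card A : ℝ) * √(Fintype.card B : ℝ) * G.classicalValue := by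
  have h0 : ∀ x y a b, 0 ≤ outcomeProb ψ (M x a) (N y b) := fun x y a b =>
    outcomeProb_nonneg ψ ((hM x).isHermitian a) ((hM x).mul_self a) ((hN y).isHermitian b)
      ((hN y).mul_self b)
  have hp0 : ∀ x a, 0 ≤ outcomeProb ψ (M x a) 1 := fun x a =>
    outcomeProb_nonneg ψ ((hM x).isHermitian a) ((hM x).mul_self a) isHermitian_one (one_mul 1)
  have hq0 : ∀ y b, 0 ≤ outcomeProb ψ 1 (N y b) := fun y b =>
    outcomeProb_nonneg ψ isHermitian_one (one_mul 1) ((hN y).isHermitian b) ((hN y).mul_self b)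
  have h11 : outcomeProb ψ 1 1 = 1 := by
    simp only [outcomeProb, Matrix.kronecker]
    rw [Matrix.one_kronecker_one, Matrix.one_mulVec, hψ, Complex.one_re]
  have hp1 : ∀ x, ∑ a, outcomeProb ψ (M x a) 1 = 1 := fun x => by
    rw [outcomeProb_sum_left, (hM x).sum_eq_one, h11]
  have hq1 : ∀ y, ∑ b, outcomeProb ψ 1 (N y b) = 1 := fun y => by
    rw [outcomeProb_sum_right, (hN y).sum_eq_one, h11]
  -- Total mass `1` forces a pair of questions to exist; the marginals there sum to `1`, so neither
  -- answer alphabet is empty.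
  have hXY : ∃ x y, G.prob x y ≠ 0 := by
    by_contra! h
    have := G.prob_sum
    simp [h] at this
  obtain ⟨x₀, y₀, -⟩ := hXY
  have hA : Nonempty A := by
    by_contra h
    rw [not_nonempty_iff] at h
    simpa using hp1 x₀
  have hB : Nonempty B := by
    by_contra h
    rw [not_nonempty_iff] at h
    simpa using hq1 y₀
  have hle : ∀ x y a b, outcomeProb ψ (M x a) (N y b)
      ≤ √(outcomeProb ψ (M x a) 1) * √(outcomeProb ψ 1 (N y b)) := by
    intro x y a b
    -- Expanding `1 = ∑ b, N y b` makes the joint probability one term of a nonnegative sum equal to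
    -- the marginal.
    have hl : outcomeProb ψ (M x a) (N y b) ≤ outcomeProb ψ (M x a) 1 := by
      rw [← (hN y).sum_eq_one, ← outcomeProb_sum_right]
      exact Finset.single_le_sum (f := fun b => outcomeProb ψ (M x a) (N y b))
        (fun b _ => h0 x y a b) (Finset.mem_univ b)
    have hr : outcomeProb ψ (M x a) (N y b) ≤ outcomeProb ψ 1 (N y b) := by
      rw [← (hM x).sum_eq_one, ← outcomeProb_sum_left]
      exact Finset.single_le_sum (f := fun a => outcomeProb ψ (M x a) (N y b))
        (fun a _ => h0 x y a b) (Finset.mem_univ a)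
    -- From `r ≤ p` and `r ≤ q` with `r ≥ 0`, `r² ≤ p * q`.
    rw [← Real.sqrt_mul (hp0 x a)]
    refine Real.le_sqrt_of_sq_le ?_
    rw [sq]
    exact mul_le_mul hl hr (h0 x y a b) (hp0 x a)
  refine le_trans ?_ (G.sum_mul_le_mul_classicalValue
    (f := fun x a => √(outcomeProb ψ (M x a) 1)) (g := fun y b => √(outcomeProb ψ 1 (N y b)))
    (fun _ _ => Real.sqrt_nonneg _) (fun _ _ => Real.sqrt_nonneg _)
    (fun x => sum_sqrt_le_sqrt_card (hp0 x) (hp1 x))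
    (fun y => sum_sqrt_le_sqrt_card (hq0 y) (hq1 y)) (Real.sqrt_nonneg _) (Real.sqrt_nonneg _))
  refine Finset.sum_le_sum fun x _ => Finset.sum_le_sum fun y _ =>
    mul_le_mul_of_nonneg_left (Finset.sum_le_sum fun a _ => Finset.sum_le_sum fun b _ =>
      mul_le_mul_of_nonneg_left (hle x y a b) ?_) (G.prob_nonneg x y)
  split_ifs <;> norm_num

theorem entangledValue_le_sqrt_mul_classicalValue (G : TwoProverGame X Y A B) :
    G.entangledValue
      ≤ √((Fintype.card A : ℝ) * (Fintype.card B : ℝ)) * G.classicalValue := by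
  rw [Real.sqrt_mul (Nat.cast_nonneg _)]
  -- The set of values can be empty, as for `d = 0`, where no unit vector exists; its `sSup` is then
  -- `0`, so the bound must also be shown nonnegative.
  refine le_of_tendsto' G.tendsto_entangledValue fun d => Real.sSup_le ?_
    (mul_nonneg (by positivity) G.classicalValue_nonneg)
  rintro r ⟨ψ, M, N, hψ, hM, hN, rfl⟩
  exact G.quantumStrategyValue_le hψ hM hN

end TwoProverGame

theorem mainTheorem3 {X Y A B : Type*} [Fintype X] [Fintype Y] [Fintype A] [Fintype B] :
    (∀ G : TwoProverGame X Y A B,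
      G.entangledValue ≤ Real.pi / (2 * Real.log (1 + Real.sqrt 2)) *
        Real.sqrt ((Fintype.card A : ℝ) * (Fintype.card B : ℝ)) * G.classicalValue) ∧
    TwoProverGame.maximalRatio X Y A B ≤
      ((Real.pi / (2 * Real.log (1 + Real.sqrt 2)) *
        Real.sqrt ((Fintype.card A : ℝ) * (Fintype.card B : ℝ)) : ℝ) : EReal) := by
  have key : ∀ G : TwoProverGame X Y A B,
      G.entangledValue ≤ Real.pi / (2 * Real.log (1 + Real.sqrt 2)) *
        Real.sqrt ((Fintype.card A : ℝ) * (Fintype.card B : ℝ)) * G.classicalValue := by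
    intro G
    refine G.entangledValue_le_sqrt_mul_classicalValue.trans ?_
    exact mul_le_mul_of_nonneg_right
      (le_mul_of_one_le_left (Real.sqrt_nonneg _) one_le_pi_div_two_mul_log_one_add_sqrt_two)
      G.classicalValue_nonneg
  refine ⟨key, iSup₂_le fun G hG => EReal.coe_le_coe_iff.mpr ?_⟩
  exact (div_le_iff₀ (lt_of_le_of_ne G.classicalValue_nonneg hG.symm)).mpr (key G)
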